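/- Let $N\ge 0$ and let $\mathfrak g=\mathfrak q(N)$ be the queer Lie superalgebra over $\mathbb C$, that is, the space of all block matrices $\begin{pmatrix}S&S'\\S'&S\end{pmatrix}$ with $S,S'\in M_N(\mathbb C)$ under the supercommutator, where the even part $\mathfrak g_{\bar 0}\cong\mathfrak{gl}(N)$ is given by $S'=0$ and the odd part $\mathfrak g_{\bar 1}$ by $S=0$. Let $\Pi:\mathfrak g\to\mathfrak g$ be the linear map interchanging $S$ and $S'$, and let $(x,y)=\operatorname{otr}(xy)$, where $\operatorname{otr}\begin{pmatrix}A&B\\B&A\end{pmatrix}=\operatorname{tr}B$. Let $\chi\in\mathfrak g_{\bar 0}^*$ be a nilpotent linear functional (it corresponds to a nilpotent matrix under the trace form of $\mathfrak{gl}(N)$), extended to $\mathfrak g$ by $\chi(\mathfrak g_{\bar 1})=0$. Let $E\in\mathfrak g_{\bar 1}$ be the element with $\chi=(E,-)$, and put $e=\Pi(E)\in\mathfrak g_{\bar 0}=\mathfrak{gl}(N)$. A $\mathbb Z$-grading $\Gamma:\mathfrak g=\bigoplus_{j\in\mathbb Z}\mathfrak g_j$ is a grading of $\mathfrak g$ as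 a Lie superalgebra that is compatible with parity: $\mathfrak g_j=(\mathfrak g_j\cap\mathfrak g_{\bar 0})\oplus(\mathfrak g_j\cap\mathfrak g_{\bar 1})$ and $[\mathfrak g_i,\mathfrak g_j]\subseteq\mathfrak g_{i+j}$. It is called good for $\chi$ if the center of $\mathfrak g$ is contained in $\mathfrak g_0$, $\chi(\mathfrak g_j)=0$ for all $j\ne-2$, and $\mathfrak g_\chi\subseteq\bigoplus_{j\ge0}\mathfrak g_j$, where $\mathfrak g_\chi$ is the sum of the spaces $\{y\in\mathfrak g_{i}\mid\chi([y,\mathfrak g])=0\}$ for $i\in\{\bar 0,\bar 1\}$. A $\mathbb Z$-grading $\mathfrak{gl}(N)=\bigoplus_{j\in\mathbb Z}\mathfrak a_j$ of the Lie algebra $\mathfrak{gl}(N)$ is called good for $e$ if the center of $\mathfrak{gl}(N)$ is contained in $\mathfrak a_0$, $e\in\mathfrak a_2$, and the centralizer of $e$ in $\mathfrak{gl}(N)$ is contained in $\bigoplus_{j\ge0}\mathfrak a_j$. Then a $\mathbb Z$-grading $\Gamma:\mathfrak g=\bigoplus_{j\in\mathbb Z}\mathfrak g_j$ of $\mathfrak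 g$ is good for $\chi$ if and only if its restriction $\mathfrak g_{\bar 0}=\bigoplus_{j\in\mathbb Z}(\mathfrak g_j\cap\mathfrak g_{\bar 0})$ to the even part is a $\mathbb Z$-grading of $\mathfrak{gl}(N)$ that is good for $e$. -/

import Mathlib

open Matrix

attribute [local instance 100] LieRing.ofAssociativeRing

/-- The space of `(N|N) × (N|N)` block matrices underlying the Lie superalgebra `gl(N|N)`. -/
abbrev BlockMat (N : ℕ) : Type := Matrix (Fin N ⊕ Fin N) (Fin N ⊕ Fin N) ℂ

namespace BlockMat

variable {N : ℕ}

/-- The even component of a block matrix (its diagonal blocks). -/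
def evenComp (X : BlockMat N) : BlockMat N := fromBlocks X.toBlocks₁₁ 0 0 X.toBlocks₂₂

/-- The odd component of a block matrix (its off-diagonal blocks). -/
def oddComp (X : BlockMat N) : BlockMat N := fromBlocks 0 X.toBlocks₁₂ X.toBlocks₂₁ 0

/-- The supercommutator of `gl(N|N)`: the bilinear extension of
`[X, Y] = X Y - (-1)^(|X||Y|) Y X` for homogeneous `X`, `Y`. -/
def superComm (X Y : BlockMat N) : BlockMat N :=
  X * Y - (evenComp Y * evenComp X + evenComp Y * oddComp X
    + oddComp Y * evenComp X - oddComp Y * oddComp X)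

/-- The odd trace: the trace of the upper right block. -/
def otr (X : BlockMat N) : ℂ := trace X.toBlocks₁₂

lemma evenComp_add (X Y : BlockMat N) : evenComp (X + Y) = evenComp X + evenComp Y := by
  ext (i | i) (j | j) <;> simp [evenComp, toBlocks₁₁, toBlocks₂₂]

lemma oddComp_add (X Y : BlockMat N) : oddComp (X + Y) = oddComp X + oddComp Y := by
  ext (i | i) (j | j) <;> simp [oddComp, toBlocks₁₂, toBlocks₂₁]

lemma evenComp_smul (c : ℂ) (X : BlockMat N) : evenComp (c • X) = c • evenComp X := by
  ext (i | i) (j | j) <;> simp [evenComp, toBlocks₁₁, toBlocks₂₂]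

lemma oddComp_smul (c : ℂ) (X : BlockMat N) : oddComp (c • X) = c • oddComp X := by
  ext (i | i) (j | j) <;> simp [oddComp, toBlocks₁₂, toBlocks₂₁]

/-- The supercommutator of `(S, S'; S', S)` and `(T, T'; T', T)`. -/
lemma superComm_fromBlocks (S S' T T' : Matrix (Fin N) (Fin N) ℂ) :
    superComm (fromBlocks S S' S' S) (fromBlocks T T' T' T) =
      fromBlocks (S * T - T * S + (S' * T' + T' * S')) (S * T' - T' * S + (S' * T - T * S'))
        (S * T' - T' * S + (S' * T - T * S')) (S * T - T * S + (S' * T' + T' * S')) := by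
  simp only [superComm, evenComp, oddComp, toBlocks_fromBlocks₁₁, toBlocks_fromBlocks₁₂,
    toBlocks_fromBlocks₂₁, toBlocks_fromBlocks₂₂, fromBlocks_multiply, fromBlocks_add,
    sub_eq_add_neg, fromBlocks_neg, zero_mul, mul_zero, add_zero, zero_add, neg_zero]
  congr 1 <;> abel

end BlockMat

/-- The queer Lie superalgebra `q(N)` as a space of matrices: all block matrices
`(S, S'; S', S)`. -/
def queer (N : ℕ) : Submodule ℂ (BlockMat N) where
  carrier := {X | ∃ S S' : Matrix (Fin N) (Fin N) ℂ, X = fromBlocks S S' S' S}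
  add_mem' := by
    rintro _ _ ⟨S, S', rfl⟩ ⟨T, T', rfl⟩
    exact ⟨S + T, S' + T', by rw [fromBlocks_add]⟩
  zero_mem' := ⟨0, 0, fromBlocks_zero.symm⟩
  smul_mem' := by
    rintro c _ ⟨S, S', rfl⟩
    exact ⟨c • S, c • S', by rw [fromBlocks_smul]⟩

namespace Queer

open BlockMat

variable {N : ℕ}

/-- The element `(S, S'; S', S)` of `q(N)`. -/
def mk (S S' : Matrix (Fin N) (Fin N) ℂ) : queer N := ⟨fromBlocks S S' S' S, S, S', rfl⟩

/-- The block `S` of `(S, S'; S', S)`. -/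
def diagBlock (X : queer N) : Matrix (Fin N) (Fin N) ℂ := X.1.toBlocks₁₁

/-- The block `S'` of `(S, S'; S', S)`. -/
def offBlock (X : queer N) : Matrix (Fin N) (Fin N) ℂ := X.1.toBlocks₁₂

@[simp] lemma diagBlock_mk (S S' : Matrix (Fin N) (Fin N) ℂ) : diagBlock (mk S S') = S := rfl

@[simp] lemma offBlock_mk (S S' : Matrix (Fin N) (Fin N) ℂ) : offBlock (mk S S') = S' := rfl

@[simp] lemma mk_blocks (X : queer N) : mk (diagBlock X) (offBlock X) = X := by
  obtain ⟨_, S, S', rfl⟩ := X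
  rfl

/-- The even part of `q(N)`, where `S' = 0`. -/
def even (N : ℕ) : Submodule ℂ (queer N) where
  carrier := {X | offBlock X = 0}
  add_mem' {X Y} hX hY := by
    change offBlock X + offBlock Y = 0
    rw [show offBlock X = 0 from hX, show offBlock Y = 0 from hY, add_zero]
  zero_mem' := rfl
  smul_mem' c X hX := by
    change c • offBlock X = 0
    rw [show offBlock X = 0 from hX, smul_zero]

/-- The odd part of `q(N)`, where `S = 0`. -/
def odd (N : ℕ) : Submodule ℂ (queer N) where
  carrier := {X | diagBlock X = 0}
  add_mem' {X Y} hX hY := by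
    change diagBlock X + diagBlock Y = 0
    rw [show diagBlock X = 0 from hX, show diagBlock Y = 0 from hY, add_zero]
  zero_mem' := rfl
  smul_mem' c X hX := by
    change c • diagBlock X = 0
    rw [show diagBlock X = 0 from hX, smul_zero]

lemma superComm_mem (X Y : queer N) : superComm X.1 Y.1 ∈ queer N := by
  obtain ⟨_, S, S', rfl⟩ := X
  obtain ⟨_, T, T', rfl⟩ := Y
  exact ⟨_, _, superComm_fromBlocks S S' T T'⟩

/-- The Lie superbracket of `q(N)`, the supercommutator of matrices, as a bilinear map. -/
def bracket (N : ℕ) : queer N →ₗ[ℂ] queer N →ₗ[ℂ] queer N :=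
  LinearMap.mk₂ ℂ (fun X Y => ⟨superComm X.1 Y.1, superComm_mem X Y⟩)
    (fun X X' Y => Subtype.ext (by
      simp only [superComm, Submodule.coe_add, evenComp_add, oddComp_add, add_mul, mul_add]; abel))
    (fun c X Y => Subtype.ext (by
      simp only [superComm, Submodule.coe_smul, evenComp_smul, oddComp_smul, Matrix.smul_mul,
        Matrix.mul_smul, smul_sub, smul_add]))
    (fun X Y Y' => Subtype.ext (by
      simp only [superComm, Submodule.coe_add, evenComp_add, oddComp_add, add_mul, mul_add]; abel))
    (fun c X Y => Subtype.ext (by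
      simp only [superComm, Submodule.coe_smul, evenComp_smul, oddComp_smul, Matrix.smul_mul,
        Matrix.mul_smul, smul_sub, smul_add]))

lemma bracket_mk (S S' T T' : Matrix (Fin N) (Fin N) ℂ) :
    bracket N (mk S S') (mk T T') =
      mk (S * T - T * S + (S' * T' + T' * S')) (S * T' - T' * S + (S' * T - T * S')) :=
  Subtype.ext (superComm_fromBlocks S S' T T')

/-- The center of `q(N)`. -/
def center (N : ℕ) : Submodule ℂ (queer N) := LinearMap.ker (bracket N)

/-- The odd invariant bilinear form `(X, Y) = otr (X Y)`. -/
def oddForm (X Y : queer N) : ℂ := otr (X.1 * Y.1)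

lemma oddForm_mk (S S' T T' : Matrix (Fin N) (Fin N) ℂ) :
    oddForm (mk S S') (mk T T') = trace (S * T' + S' * T) := by
  simp [oddForm, otr, mk, fromBlocks_multiply]

/-- The odd involution `Π`, interchanging `S` and `S'` in `(S, S'; S', S)`. -/
def parity (N : ℕ) : queer N →ₗ[ℂ] queer N where
  toFun X := mk (offBlock X) (diagBlock X)
  map_add' _ _ := Subtype.ext (fromBlocks_add _ _ _ _ _ _ _ _).symm
  map_smul' c X := Subtype.ext
    (fromBlocks_smul c (offBlock X) (diagBlock X) (diagBlock X) (offBlock X)).symm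

/-- The identification of `gl(N)` with the even part of `q(N)`: `S ↦ (S, 0; 0, S)`. -/
def evenIncl (N : ℕ) : Matrix (Fin N) (Fin N) ℂ →ₗ[ℂ] queer N where
  toFun S := mk S 0
  map_add' _ _ := Subtype.ext (by simp [mk, fromBlocks_add])
  map_smul' _ _ := Subtype.ext (by simp [mk, fromBlocks_smul])

lemma evenIncl_injective : Function.Injective (evenIncl N) :=
  fun S T h => congrArg diagBlock (show mk S 0 = mk T 0 from h)

lemma range_evenIncl : LinearMap.range (evenIncl N) = even N := by
  ext X
  constructor
  · rintro ⟨S, rfl⟩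
    rfl
  · intro hX
    refine ⟨diagBlock X, ?_⟩
    change mk (diagBlock X) 0 = X
    rw [← show offBlock X = 0 from hX, mk_blocks]

lemma evenIncl_lie (S T : Matrix (Fin N) (Fin N) ℂ) :
    evenIncl N ⁅S, T⁆ = bracket N (evenIncl N S) (evenIncl N T) := by
  change mk _ 0 = bracket N (mk S 0) (mk T 0)
  rw [bracket_mk, Ring.lie_def]
  simp

/-- Every linear functional on `q(N)` vanishing on the odd part is `(E, -)` for exactly one odd
element `E`. -/
theorem existsUnique_oddForm_eq (χ : Module.Dual ℂ (queer N)) (hχ : ∀ X ∈ odd N, χ X = 0) :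
    ∃! E : queer N, E ∈ odd N ∧ ∀ X, χ X = oddForm E X := by
  have key : ∀ S S' : Matrix (Fin N) (Fin N) ℂ, χ (mk S S') = χ (evenIncl N S) := by
    intro S S'
    have h : mk S S' = evenIncl N S + mk 0 S' :=
      Subtype.ext (by simp [evenIncl, mk, fromBlocks_add])
    rw [h, map_add, hχ (mk 0 S') rfl, add_zero]
  refine ⟨mk 0 (Matrix.of fun i j => χ (evenIncl N (Matrix.single j i 1))), ⟨rfl, ?_⟩, ?_⟩
  · intro X
    rw [← mk_blocks X, key, oddForm_mk, zero_mul, zero_add]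
    generalize diagBlock X = S
    conv_lhs => rw [Matrix.matrix_eq_sum_single S]
    simp only [map_sum, trace, diag_apply, mul_apply, of_apply]
    rw [Finset.sum_comm]
    refine Finset.sum_congr rfl fun i _ => Finset.sum_congr rfl fun j _ => ?_
    rw [show Matrix.single j i (S j i) = S j i • Matrix.single j i (1 : ℂ) by
      rw [Matrix.smul_single, smul_eq_mul, mul_one], map_smul, map_smul, smul_eq_mul, mul_comm]
  · rintro E ⟨hE, h⟩
    rw [← mk_blocks E, show diagBlock E = 0 from hE]
    congr 1
    ext i j
    rw [of_apply, h, ← mk_blocks E]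
    change _ = oddForm (mk (diagBlock E) (offBlock E)) (mk (Matrix.single j i 1) 0)
    rw [oddForm_mk]
    simp [Matrix.trace_mul_single]

/-- A linear functional on `q(N)` is nilpotent if it vanishes on the odd part and its restriction
to the even part `gl(N)` corresponds to a nilpotent matrix under the trace form. -/
def IsNilpotentFunctional (χ : Module.Dual ℂ (queer N)) : Prop :=
  (∀ X ∈ odd N, χ X = 0) ∧
    ∃ a : Matrix (Fin N) (Fin N) ℂ, IsNilpotent a ∧ ∀ S, χ (evenIncl N S) = trace (a * S)

/-- The centralizer `g_χ` in `g = q(N)` of a functional `χ`: the sum of its even and odd parts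
`{Y ∈ g_i | χ([Y, g]) = 0}`, where `i` is `0` or `1` modulo `2`. -/
def centralizer (χ : Module.Dual ℂ (queer N)) : Submodule ℂ (queer N) :=
  (even N ⊓ LinearMap.ker ((bracket N).compr₂ χ)) ⊔ (odd N ⊓ LinearMap.ker ((bracket N).compr₂ χ))

/-- A `ℤ`-grading of the Lie superalgebra `q(N)`, compatible with the parity grading. -/
structure IsZGrading (Γ : ℤ → Submodule ℂ (queer N)) : Prop where
  isInternal : DirectSum.IsInternal Γ
  parity_compatible : ∀ j, Γ j = (Γ j ⊓ even N) ⊔ (Γ j ⊓ odd N)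
  bracket_mem : ∀ i j, ∀ X ∈ Γ i, ∀ Y ∈ Γ j, bracket N X Y ∈ Γ (i + j)

/-- A `ℤ`-grading of `q(N)` that is good for the functional `χ`. -/
structure IsGoodGrading (χ : Module.Dual ℂ (queer N)) (Γ : ℤ → Submodule ℂ (queer N)) :
    Prop extends IsZGrading Γ where
  center_le : center N ≤ Γ 0
  apply_eq_zero : ∀ j, j ≠ -2 → ∀ X ∈ Γ j, χ X = 0
  centralizer_le : centralizer χ ≤ ⨆ j : ℤ, ⨆ _ : 0 ≤ j, Γ j

/-- The restriction to the even part `gl(N)` of a family of subspaces of `q(N)`. -/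
def restrictEven (Γ : ℤ → Submodule ℂ (queer N)) (j : ℤ) :
    Submodule ℂ (Matrix (Fin N) (Fin N) ℂ) :=
  (Γ j).comap (evenIncl N)

end Queer

/-- A `ℤ`-grading of a complex Lie algebra. -/
structure IsLieZGrading {L : Type*} [LieRing L] [LieAlgebra ℂ L] (Γ : ℤ → Submodule ℂ L) :
    Prop where
  isInternal : DirectSum.IsInternal Γ
  lie_mem : ∀ i j, ∀ x ∈ Γ i, ∀ y ∈ Γ j, ⁅x, y⁆ ∈ Γ (i + j)

/-- A `ℤ`-grading of a (reductive) complex Lie algebra, with the center in degree `0`, that is good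
for the element `e`: `e` has degree `2` and its centralizer lies in non-negative degrees. -/
structure IsGoodLieGrading {L : Type*} [LieRing L] [LieAlgebra ℂ L] (e : L)
    (Γ : ℤ → Submodule ℂ L) : Prop extends IsLieZGrading Γ where
  center_le : (LieAlgebra.center ℂ L).toSubmodule ≤ Γ 0
  mem_two : e ∈ Γ 2
  centralizer_le : LinearMap.ker (LieAlgebra.ad ℂ L e) ≤ ⨆ j : ℤ, ⨆ _ : 0 ≤ j, Γ j

/-! Either notion of goodness puts the identity of `gl(N)`, hence the center of `q(N)`, in degree 0.
That rigidifies the grading. The odd element `Π(1)` must also have degree 0 (`one_mem_restrictOdd`),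
and the bracket with it then shows that `Π` preserves degrees (`restrictOdd_eq_restrictEven`). A
product `ST` is half the sum of an anticommutator and a commutator, so `gl(N)` becomes a graded
associative algebra (`gradedAlgebra`).

In such an algebra, homogeneous elements of nonzero degree are nilpotent, so the trace form pairs
only opposite degrees. Since `χ` is `trace (e * ·)` on the even part, `χ` lives in degree `-2`
exactly when `e` has degree 2.

By nondegeneracy of the trace form, the even part of `g_χ` is the centralizer of `e`, and its odd
part is the anticentralizer. Goodness for `e` says nothing directly about the latter. But scaling
degree `j` by `i ^ j` is an algebra automorphism, hence conjugation by some invertible `g`, which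
can be shown to have degree 0. As `i ^ 2 = -1`, `g` anticommutes with `e`, so multiplication by `g`
carries the anticentralizer into the centralizer without changing degrees
(`Matrix.mem_nonneg_of_anticommute`). -/

section Graded

/-! ### Graded associative algebras, in particular graded matrix algebras -/

open DirectSum

variable {R A : Type*} [CommRing R] [Ring A] [Algebra R A]

/-- A homogeneous element of nonzero degree of a finite-dimensional graded algebra is nilpotent. -/
lemma isNilpotent_of_mem_graded {K : Type*} [Field K] [Algebra K A] [FiniteDimensional K A]
    (𝒜 : ℤ → Submodule K A) [GradedAlgebra 𝒜] {j : ℤ} (hj : j ≠ 0) {x : A} (hx : x ∈ 𝒜 j) :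
    IsNilpotent x := by
  by_contra h
  have hne : ∀ k : ℕ, x ^ k ≠ 0 := fun k hk => h ⟨k, hk⟩
  -- The powers of a non-nilpotent `x` would be nonzero vectors in pairwise distinct degrees, an
  -- infinite independent family.
  have hmem : ∀ k : ℕ, x ^ k ∈ 𝒜 (k • j) := fun k => SetLike.pow_mem_graded k hx
  have hinj : Function.Injective fun k : ℕ => k • j := fun a b hab => by
    simpa [hj] using hab
  have hind : iSupIndep fun k : ℕ => 𝒜 (k • j) :=
    (Decomposition.isInternal 𝒜).submodule_iSupIndep.comp hinj
  have := (hind.linearIndependent (fun k : ℕ => 𝒜 (k • j)) hmem hne).finite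
  exact not_finite ℕ

/-- The algebra automorphism of a `ℤ`-graded algebra scaling the degree `j` component by the `j`-th
power of a unit `u`, as a linear map. -/
noncomputable def gradedTwist (𝒜 : ℤ → Submodule R A) [GradedAlgebra 𝒜] (u : Rˣ) : A →ₗ[R] A :=
  DirectSum.toModule R ℤ A (fun j => ((u ^ j : Rˣ) : R) • (𝒜 j).subtype) ∘ₗ
    (decomposeLinearEquiv 𝒜).toLinearMap

lemma gradedTwist_of_mem (𝒜 : ℤ → Submodule R A) [GradedAlgebra 𝒜] (u : Rˣ) {j : ℤ} {x : A}
    (hx : x ∈ 𝒜 j) : gradedTwist 𝒜 u x = ((u ^ j : Rˣ) : R) • x := by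
  lift x to 𝒜 j using hx
  simp only [gradedTwist, LinearMap.comp_apply, LinearEquiv.coe_coe, decomposeLinearEquiv_apply,
    decompose_coe]
  exact DirectSum.toModule_lof (M := fun i => 𝒜 i) R j x

lemma gradedTwist_inv_apply (𝒜 : ℤ → Submodule R A) [GradedAlgebra 𝒜] (u : Rˣ) (x : A) :
    gradedTwist 𝒜 u⁻¹ (gradedTwist 𝒜 u x) = x := by
  induction x using Decomposition.inductionOn 𝒜 with
  | zero => simp
  | homogeneous x =>
    rw [gradedTwist_of_mem 𝒜 u x.2, map_smul, gradedTwist_of_mem 𝒜 u⁻¹ x.2, smul_smul,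
      ← Units.val_mul, ← mul_zpow, mul_inv_cancel, _root_.one_zpow, Units.val_one, one_smul]
  | add x y hx hy => rw [map_add, map_add, hx, hy]

lemma gradedTwist_mul (𝒜 : ℤ → Submodule R A) [GradedAlgebra 𝒜] (u : Rˣ) (x y : A) :
    gradedTwist 𝒜 u (x * y) = gradedTwist 𝒜 u x * gradedTwist 𝒜 u y := by
  induction x using Decomposition.inductionOn 𝒜 with
  | zero => simp
  | add x x' hx hx' => rw [add_mul, map_add, map_add, add_mul, hx, hx']
  | homogeneous x =>
    induction y using Decomposition.inductionOn 𝒜 with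
    | zero => simp
    | add y y' hy hy' => rw [mul_add, map_add, map_add, mul_add, hy, hy']
    | homogeneous y =>
      rw [gradedTwist_of_mem 𝒜 u x.2, gradedTwist_of_mem 𝒜 u y.2,
        gradedTwist_of_mem 𝒜 u (SetLike.mul_mem_graded x.2 y.2), smul_mul_smul_comm, _root_.zpow_add,
        Units.val_mul]

/-- The algebra automorphism of a `ℤ`-graded algebra scaling the degree `j` component by the `j`-th
power of a unit `u`. -/
noncomputable def gradedTwistEquiv (𝒜 : ℤ → Submodule R A) [GradedAlgebra 𝒜] (u : Rˣ) :
    A ≃ₐ[R] A :=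
  AlgEquiv.ofLinearEquiv
    (LinearEquiv.ofLinearMap (gradedTwist 𝒜 u) (gradedTwist 𝒜 u⁻¹)
      (LinearMap.ext fun x => by simpa using gradedTwist_inv_apply 𝒜 u⁻¹ x)
      (LinearMap.ext fun x => gradedTwist_inv_apply 𝒜 u x))
    (by
      change gradedTwist 𝒜 u 1 = 1
      rw [gradedTwist_of_mem 𝒜 u SetLike.GradedOne.one_mem, zpow_zero, Units.val_one, one_smul])
    (gradedTwist_mul 𝒜 u)

/-- Automorphisms of a full matrix algebra over a field are inner. -/
lemma Matrix.exists_isUnit_mul_eq_algEquiv_mul {K n : Type*} [Field K] [Fintype n] [DecidableEq n]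
    (f : Matrix n n K ≃ₐ[K] Matrix n n K) :
    ∃ g : Matrix n n K, IsUnit g ∧ ∀ X, g * X = f X * g := by
  obtain ⟨T, hT⟩ := AlgEquiv.eq_linearEquivConjAlgEquiv
    ((Matrix.toLinAlgEquiv'.symm.trans f).trans Matrix.toLinAlgEquiv' :
      Module.End K (n → K) ≃ₐ[K] Module.End K (n → K))
  refine ⟨Matrix.toLinAlgEquiv'.symm T.toLinearMap, ?_, fun X => ?_⟩
  · exact (((LinearMap.GeneralLinearGroup.generalLinearEquiv K (n → K)).symm T).isUnit).map
      (Matrix.toLinAlgEquiv'.symm : _ ≃ₐ[K] Matrix n n K)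
  · apply Matrix.toLinAlgEquiv'.injective
    have h := DFunLike.congr_fun hT (Matrix.toLinAlgEquiv' X)
    simp only [AlgEquiv.trans_apply, AlgEquiv.symm_apply_apply] at h
    rw [map_mul, map_mul, AlgEquiv.apply_symm_apply, h]
    refine LinearMap.ext fun v => ?_
    simp [LinearEquiv.conjAlgEquiv_apply]

/-- The twist is conjugation by some unit `g`. Every homogeneous component of `g` satisfies the same
intertwining relation, so it is `g` times a central element, that is, a scalar multiple of `g`.
Hence `g` is homogeneous, and a unit cannot be nilpotent, which forces degree 0. -/
lemma Matrix.exists_isUnit_mem_zero_twist {K n : Type*} [Field K] [Fintype n] [DecidableEq n]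
    (𝒜 : ℤ → Submodule K (Matrix n n K)) [GradedAlgebra 𝒜] (u : Kˣ) :
    ∃ g ∈ 𝒜 0, IsUnit g ∧ ∀ j, ∀ X ∈ 𝒜 j, g * X = ((u ^ j : Kˣ) : K) • (X * g) := by
  rcases isEmpty_or_nonempty n with hn | hn
  · exact ⟨0, zero_mem _, isUnit_of_subsingleton _, fun j X _ => Subsingleton.elim _ _⟩
  obtain ⟨g, hg, hgX⟩ := Matrix.exists_isUnit_mul_eq_algEquiv_mul (gradedTwistEquiv 𝒜 u)
  have hgX' : ∀ j, ∀ X ∈ 𝒜 j, g * X = ((u ^ j : Kˣ) : K) • (X * g) := fun j X hX => by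
    rw [hgX, ← smul_mul_assoc, ← gradedTwist_of_mem 𝒜 u hX]
    rfl
  -- Compare the components of degree `m + j` in the relation for `g`.
  have hcomp : ∀ m j, ∀ X ∈ 𝒜 j, (decompose 𝒜 g m : Matrix n n K) * X =
      ((u ^ j : Kˣ) : K) • (X * (decompose 𝒜 g m : Matrix n n K)) := fun m j X hX => by
    rw [← coe_decompose_mul_add_of_right_mem 𝒜 hX, hgX' j X hX, add_comm,
      ← coe_decompose_mul_add_of_left_mem 𝒜 hX, decompose_smul]
    rfl
  obtain ⟨m, hm⟩ : ∃ m, (decompose 𝒜 g m : Matrix n n K) ≠ 0 := by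
    by_contra! h
    exact hg.ne_zero ((decompose 𝒜).injective (by ext1 m; ext1; simpa using h m))
  obtain ⟨v, rfl⟩ := hg
  set p : Matrix n n K := (decompose 𝒜 (v : Matrix n n K) m : Matrix n n K) with hp
  have hpm : p ∈ 𝒜 m := SetLike.coe_mem _
  have hcomm : ∀ X, Commute X ((↑v⁻¹ : Matrix n n K) * p) := fun X => by
    induction X using Decomposition.inductionOn 𝒜 with
    | zero => exact Commute.zero_left _
    | add x y hx hy => exact hx.add_left hy
    | @homogeneous j x =>
      apply (Units.mul_right_inj v).mp
      rw [← mul_assoc, hgX' j x x.2, smul_mul_assoc, mul_assoc (x : Matrix n n K),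
        Units.mul_inv_cancel_left, mul_assoc, Units.mul_inv_cancel_left, hcomp m j x x.2]
  obtain ⟨c, hc⟩ := Matrix.mem_range_scalar_of_commute_single (fun i j _ => hcomm (single i j 1))
  have hpc : p = c • (v : Matrix n n K) := by
    rw [← Units.mul_inv_cancel_left v p, ← hc, scalar_apply, ← smul_one_eq_diagonal]
    simp
  have hc0 : c ≠ 0 := by
    rintro rfl
    exact hm (by rw [hpc, zero_smul])
  have hvm : (v : Matrix n n K) ∈ 𝒜 m := by
    rwa [hpc, Submodule.smul_mem_iff _ hc0] at hpm
  have hm0 : m = 0 := by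
    by_contra h
    exact (isNilpotent_of_mem_graded 𝒜 h hvm).not_isUnit v.isUnit
  exact ⟨v, hm0 ▸ hvm, v.isUnit, hgX'⟩

/-- The trace form pairs only opposite degrees of a grading of a matrix algebra. -/
lemma Matrix.trace_mul_eq_zero_of_graded {K n : Type*} [Field K] [Fintype n] [DecidableEq n]
    (𝒜 : ℤ → Submodule K (Matrix n n K)) [GradedAlgebra 𝒜] {i j : ℤ} (hij : i + j ≠ 0)
    {X Y : Matrix n n K} (hX : X ∈ 𝒜 i) (hY : Y ∈ 𝒜 j) : trace (X * Y) = 0 :=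
  (Matrix.isNilpotent_trace_of_isNilpotent
    (isNilpotent_of_mem_graded 𝒜 hij (SetLike.mul_mem_graded hX hY))).eq_zero

lemma DirectSum.mem_iSup_nonneg_iff {M : Type*} [AddCommGroup M] [Module R M]
    (ℳ : ℤ → Submodule R M) [Decomposition ℳ] (x : M) :
    x ∈ ⨆ j : ℤ, ⨆ _ : 0 ≤ j, ℳ j ↔ ∀ j < 0, (decompose ℳ x j : M) = 0 := by
  constructor
  · intro hx j hj
    have hle : ⨆ i : ℤ, ⨆ _ : 0 ≤ i, ℳ i ≤
        LinearMap.ker ((ℳ j).subtype ∘ₗ DirectSum.component R ℤ (fun i => ℳ i) j ∘ₗ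
          (decomposeLinearEquiv ℳ).toLinearMap) :=
      iSup₂_le fun i hi y hy => decompose_of_mem_ne ℳ hy (by lia)
    exact hle hx
  · intro h
    classical
    rw [← sum_support_decompose ℳ x]
    refine sum_mem fun j _ => ?_
    rcases lt_or_ge j 0 with hj | hj
    · rw [h j hj]; exact zero_mem _
    · exact Submodule.mem_iSup_of_mem j (Submodule.mem_iSup_of_mem hj (SetLike.coe_mem _))

lemma DirectSum.mem_of_decompose_eq_zero {M : Type*} [AddCommGroup M] [Module R M]
    (ℳ : ℤ → Submodule R M) [Decomposition ℳ] {x : M} {i : ℤ}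
    (h : ∀ j ≠ i, (decompose ℳ x j : M) = 0) : x ∈ ℳ i := by
  classical
  rw [← sum_support_decompose ℳ x]
  refine sum_mem fun j _ => ?_
  rcases eq_or_ne j i with rfl | hj
  · exact SetLike.coe_mem _
  · rw [h j hj]; exact zero_mem _

/-- The anticentralizer of an element of degree `2` lies in nonnegative degrees if the centralizer
does. -/
lemma Matrix.mem_nonneg_of_anticommute {n : Type*} [Fintype n] [DecidableEq n]
    (𝒜 : ℤ → Submodule ℂ (Matrix n n ℂ)) [GradedAlgebra 𝒜] {e : Matrix n n ℂ} (he : e ∈ 𝒜 2)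
    (hcent : ∀ Y, e * Y = Y * e → Y ∈ ⨆ j : ℤ, ⨆ _ : 0 ≤ j, 𝒜 j) {Y : Matrix n n ℂ}
    (hY : e * Y + Y * e = 0) : Y ∈ ⨆ j : ℤ, ⨆ _ : 0 ≤ j, 𝒜 j := by
  obtain ⟨g, hg0, hg, hgX⟩ :=
    Matrix.exists_isUnit_mem_zero_twist 𝒜 (Units.mk0 Complex.I Complex.I_ne_zero)
  have hge : g * e = -(e * g) := by
    have h := hgX 2 e he
    -- The unit `i` is chosen so that its square is the sign relating commuting to anticommuting.
    rwa [show (Units.mk0 Complex.I Complex.I_ne_zero ^ (2 : ℤ) : ℂˣ) = -1 by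
      ext; simp [zpow_ofNat], Units.val_neg, Units.val_one, neg_one_smul] at h
  have hgY := hcent (g * Y) (by
    rw [mul_assoc g Y e, eq_neg_of_add_eq_zero_right hY, mul_neg, ← mul_assoc g e, hge, neg_mul,
      neg_neg, mul_assoc])
  rw [DirectSum.mem_iSup_nonneg_iff] at hgY ⊢
  intro j hj
  have h := hgY j hj
  rw [coe_decompose_mul_of_left_mem_zero 𝒜 hg0] at h
  exact hg.mul_right_eq_zero.mp h

/-- A direct sum decomposition passes to a retract when the idempotent `f ∘ p` respects it. Applied
to the even and odd parts of `q(N)`. -/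
lemma DirectSum.IsInternal.comap {V W : Type*} [AddCommGroup V] [Module R V] [AddCommGroup W]
    [Module R W] {Γ : ℤ → Submodule R W} (hΓ : DirectSum.IsInternal Γ) {f : V →ₗ[R] W}
    {p : W →ₗ[R] V} (hpf : ∀ v, p (f v) = v) (hp : ∀ j, ∀ w ∈ Γ j, f (p w) ∈ Γ j) :
    DirectSum.IsInternal fun j => (Γ j).comap f := by
  apply DirectSum.isInternal_submodule_of_iSupIndep_of_iSup_eq_top
  · intro i
    rw [Submodule.disjoint_def]
    intro x hx hx'
    have hle : ⨆ j, ⨆ _ : j ≠ i, (Γ j).comap f ≤ (⨆ j, ⨆ _ : j ≠ i, Γ j).comap f :=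
      iSup₂_le fun j hj => Submodule.comap_mono (le_iSup₂_of_le j hj le_rfl)
    rw [← hpf x, Submodule.disjoint_def.mp (hΓ.submodule_iSupIndep i) _ hx (hle hx'), map_zero]
  · rw [eq_top_iff]
    intro x _
    have hle : ⨆ j, Γ j ≤ (⨆ j, (Γ j).comap f).comap p :=
      iSup_le fun j w hw => Submodule.mem_iSup_of_mem j (hp j w hw)
    have h := hle (hΓ.submodule_iSup_eq_top.symm ▸ Submodule.mem_top : f x ∈ ⨆ j, Γ j)
    rwa [Submodule.mem_comap, hpf] at h

end Graded

/-! ### Even and odd parts and the center of `q(N)` -/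

namespace Queer

variable {N : ℕ}

/-- The identification of `gl(N)` with the odd part of `q(N)`: `S ↦ (0, S; S, 0)`. -/
def oddIncl (N : ℕ) : Matrix (Fin N) (Fin N) ℂ →ₗ[ℂ] queer N := parity N ∘ₗ evenIncl N

lemma oddIncl_apply (S : Matrix (Fin N) (Fin N) ℂ) : oddIncl N S = mk 0 S := rfl

lemma evenIncl_apply (S : Matrix (Fin N) (Fin N) ℂ) : evenIncl N S = mk S 0 := rfl

/-- The linear map sending `(S, S'; S', S)` to `S`. -/
def diagBlockₗ (N : ℕ) : queer N →ₗ[ℂ] Matrix (Fin N) (Fin N) ℂ where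
  toFun := diagBlock
  map_add' _ _ := rfl
  map_smul' _ _ := rfl

/-- The linear map sending `(S, S'; S', S)` to `S'`. -/
def offBlockₗ (N : ℕ) : queer N →ₗ[ℂ] Matrix (Fin N) (Fin N) ℂ where
  toFun := offBlock
  map_add' _ _ := rfl
  map_smul' _ _ := rfl

lemma mem_even_iff {X : queer N} : X ∈ even N ↔ evenIncl N (diagBlock X) = X := by
  constructor
  · intro h
    rw [evenIncl_apply, ← show offBlock X = 0 from h, mk_blocks]
  · intro h
    rw [← h]
    rfl

lemma mem_odd_iff {X : queer N} : X ∈ odd N ↔ oddIncl N (offBlock X) = X := by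
  constructor
  · intro h
    rw [oddIncl_apply, ← show diagBlock X = 0 from h, mk_blocks]
  · intro h
    rw [← h]
    rfl

/-- The restriction to the odd part of a family of subspaces of `q(N)`, as a family of spaces of
`N × N` matrices. -/
def restrictOdd (Γ : ℤ → Submodule ℂ (queer N)) (j : ℤ) :
    Submodule ℂ (Matrix (Fin N) (Fin N) ℂ) :=
  (Γ j).comap (oddIncl N)

lemma exists_eq_smul_one_of_forall_commute {X : Matrix (Fin N) (Fin N) ℂ}
    (h : ∀ Y : Matrix (Fin N) (Fin N) ℂ, X * Y = Y * X) : ∃ c : ℂ, X = c • 1 := by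
  obtain ⟨c, hc⟩ := Matrix.mem_range_scalar_of_commute_single
    (fun i j _ => (h (single i j 1)).symm)
  exact ⟨c, by rw [← hc, scalar_apply, smul_one_eq_diagonal]⟩

lemma evenIncl_one_mem_center : evenIncl N 1 ∈ center N := by
  refine LinearMap.mem_ker.mpr (LinearMap.ext fun Y => ?_)
  rw [← mk_blocks Y, evenIncl_apply, bracket_mk]
  simp only [one_mul, mul_one, zero_mul, mul_zero, sub_self, add_zero]
  exact Subtype.ext fromBlocks_zero

lemma exists_eq_evenIncl_of_mem_center {X : queer N} (hX : X ∈ center N) :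
    ∃ c : ℂ, X = evenIncl N (c • 1) := by
  have h : ∀ T T', bracket N X (mk T T') = 0 := fun T T' => by
    rw [show bracket N X = 0 from hX, LinearMap.zero_apply]
  rw [← mk_blocks X] at h
  simp only [bracket_mk] at h
  have hoff : offBlock X = 0 := by
    -- The bracket with `Π(1)` has even part twice the off-diagonal block.
    have h1 := congrArg diagBlock (h 0 1)
    simp only [diagBlock_mk, mul_zero, zero_mul, mul_one, one_mul, sub_self, zero_add] at h1
    rw [← two_smul ℂ] at h1
    exact (smul_eq_zero.mp h1).resolve_left two_ne_zero
  obtain ⟨c, hc⟩ := exists_eq_smul_one_of_forall_commute (X := diagBlock X) fun Y => by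
    have h1 := congrArg diagBlock (h Y 0)
    simp only [diagBlock_mk, mul_zero, zero_mul, add_zero] at h1
    exact sub_eq_zero.mp h1
  refine ⟨c, ?_⟩
  rw [← hc, mem_even_iff.mp hoff]

variable {Γ : ℤ → Submodule ℂ (queer N)}

/-! ### Gradings of `q(N)` with center in degree 0 -/

namespace IsZGrading

lemma blocks_mem (hΓ : IsZGrading Γ) {j : ℤ} {X : queer N} (hX : X ∈ Γ j) :
    evenIncl N (diagBlock X) ∈ Γ j ∧ oddIncl N (offBlock X) ∈ Γ j := by
  rw [hΓ.parity_compatible j] at hX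
  obtain ⟨U, ⟨hU, hUe⟩, V, ⟨hV, hVo⟩, rfl⟩ := Submodule.mem_sup.mp hX
  have h1 : diagBlock (U + V) = diagBlock U := by
    change diagBlock U + diagBlock V = _
    rw [show diagBlock V = 0 from hVo, add_zero]
  have h2 : offBlock (U + V) = offBlock V := by
    change offBlock U + offBlock V = _
    rw [show offBlock U = 0 from hUe, zero_add]
  rw [h1, h2, mem_even_iff.mp hUe, mem_odd_iff.mp hVo]
  exact ⟨hU, hV⟩

lemma isInternal_restrictEven (hΓ : IsZGrading Γ) : DirectSum.IsInternal (restrictEven Γ) :=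
  hΓ.isInternal.comap (p := diagBlockₗ N) (fun _ => rfl) fun _ _ hX => (hΓ.blocks_mem hX).1

lemma isInternal_restrictOdd (hΓ : IsZGrading Γ) : DirectSum.IsInternal (restrictOdd Γ) :=
  hΓ.isInternal.comap (p := offBlockₗ N) (fun _ => rfl) fun _ _ hX => (hΓ.blocks_mem hX).2

lemma isLieZGrading_restrictEven (hΓ : IsZGrading Γ) : IsLieZGrading (restrictEven Γ) where
  isInternal := hΓ.isInternal_restrictEven
  lie_mem i j x hx y hy := by
    change evenIncl N _ ∈ Γ (i + j)
    rw [evenIncl_lie]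
    exact hΓ.bracket_mem i j _ hx _ hy

lemma commutator_mem_restrictOdd (hΓ : IsZGrading Γ) {i j : ℤ} {S T : Matrix (Fin N) (Fin N) ℂ}
    (hS : S ∈ restrictEven Γ i) (hT : T ∈ restrictOdd Γ j) :
    S * T - T * S ∈ restrictOdd Γ (i + j) := by
  have h := hΓ.bracket_mem i j _ hS _ hT
  rw [evenIncl_apply, oddIncl_apply, bracket_mk] at h
  simp only [zero_mul, mul_zero, sub_self, add_zero] at h
  exact h

lemma anticommutator_mem_restrictEven (hΓ : IsZGrading Γ) {i j : ℤ}
    {S T : Matrix (Fin N) (Fin N) ℂ} (hS : S ∈ restrictOdd Γ i) (hT : T ∈ restrictOdd Γ j) :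
    S * T + T * S ∈ restrictEven Γ (i + j) := by
  have h := hΓ.bracket_mem i j _ hS _ hT
  rw [oddIncl_apply, oddIncl_apply, bracket_mk] at h
  simp only [zero_mul, mul_zero, sub_self, add_zero, zero_add] at h
  exact h

open DirectSum in
/-- If the center of `q(N)` has degree zero, then so has the odd element `(0, 1; 1, 0)`. -/
lemma one_mem_restrictOdd (hΓ : IsZGrading Γ) (h1 : 1 ∈ restrictEven Γ 0) :
    1 ∈ restrictOdd Γ 0 := by
  rcases subsingleton_or_nontrivial (Matrix (Fin N) (Fin N) ℂ) with hs | hs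
  · rw [Subsingleton.elim (1 : Matrix (Fin N) (Fin N) ℂ) 0]
    exact zero_mem _
  let := hΓ.isInternal_restrictOdd.chooseDecomposition
  let := hΓ.isInternal_restrictEven.chooseDecomposition
  set o : ℤ → Matrix (Fin N) (Fin N) ℂ := fun j => decompose (restrictOdd Γ) 1 j with ho
  have ho_mem : ∀ j, o j ∈ restrictOdd Γ j := fun j => SetLike.coe_mem _
  -- For `x` of degree `i`, the component of degree `i + j` of `[x, 1] = 0` is `[x, o j]`, so every
  -- component of `Π(1)` is scalar.
  have hcomm : ∀ j T, o j * T = T * o j := fun j T => by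
    induction T using Decomposition.inductionOn (restrictEven Γ) with
    | zero => simp
    | add x y hx hy => rw [mul_add, add_mul, hx, hy]
    | @homogeneous i x =>
      have hzero : ∑ k ∈ (decompose (restrictOdd Γ) 1).support, ((x : Matrix (Fin N) (Fin N) ℂ) * o k -
          o k * (x : Matrix (Fin N) (Fin N) ℂ)) = 0 := by
        rw [Finset.sum_sub_distrib, ← Finset.mul_sum, ← Finset.sum_mul, ho,
          sum_support_decompose, mul_one, one_mul, sub_self]
      have hdec := congrArg ((restrictOdd Γ (i + j)).subtype ∘ₗ
        DirectSum.component ℂ ℤ (fun k => restrictOdd Γ k) (i + j) ∘ₗ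
          (decomposeLinearEquiv (restrictOdd Γ)).toLinearMap) hzero
      rw [map_sum, map_zero] at hdec
      change ∑ k ∈ _, (decompose (restrictOdd Γ) (x * o k - o k * x) (i + j) :
        Matrix (Fin N) (Fin N) ℂ) = 0 at hdec
      rw [Finset.sum_eq_single j] at hdec
      · rw [decompose_of_mem_same _ (hΓ.commutator_mem_restrictOdd x.2 (ho_mem j))] at hdec
        exact (sub_eq_zero.mp hdec).symm
      · intro k _ hk
        exact decompose_of_mem_ne _ (hΓ.commutator_mem_restrictOdd x.2 (ho_mem k)) (by simpa using hk)
      · intro hj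
        rw [DFinsupp.notMem_support_iff] at hj
        simp [ho, hj]
  obtain ⟨j, hj⟩ : ∃ j, o j ≠ 0 := by
    by_contra! h
    refine one_ne_zero (α := Matrix (Fin N) (Fin N) ℂ) ?_
    rw [← sum_support_decompose (restrictOdd Γ) (1 : Matrix (Fin N) (Fin N) ℂ)]
    exact Finset.sum_eq_zero fun k _ => h k
  obtain ⟨c, hc⟩ := exists_eq_smul_one_of_forall_commute (hcomm j)
  have hc0 : c ≠ 0 := by
    rintro rfl
    exact hj (by rw [hc, zero_smul])
  have hone : (1 : Matrix (Fin N) (Fin N) ℂ) ∈ restrictOdd Γ j := by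
    have h := ho_mem j
    rwa [hc, Submodule.smul_mem_iff _ hc0] at h
  -- The bracket of `Π(1)` with itself is twice the identity, so `j + j = 0`.
  have htwo := hΓ.anticommutator_mem_restrictEven hone hone
  rw [mul_one, ← two_smul ℂ (1 : Matrix (Fin N) (Fin N) ℂ), Submodule.smul_mem_iff _ two_ne_zero] at htwo
  have hdeg := degree_eq_of_mem_mem (restrictEven Γ) htwo h1 one_ne_zero
  rwa [show j = 0 by lia] at hone

-- The bracket with `Π(1)`, of degree 0, sends `Π(T)` to `2T`, which gives one inclusion. Two direct
-- sum decompositions of the same space, one contained termwise in the other, coincide.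
open DirectSum in
lemma restrictOdd_eq_restrictEven (hΓ : IsZGrading Γ) (h1 : 1 ∈ restrictEven Γ 0) :
    restrictOdd Γ = restrictEven Γ := by
  have hle : ∀ j, restrictOdd Γ j ≤ restrictEven Γ j := fun j T hT => by
    have h := hΓ.anticommutator_mem_restrictEven (hΓ.one_mem_restrictOdd h1) hT
    rwa [one_mul, mul_one, ← two_smul ℂ, Submodule.smul_mem_iff _ two_ne_zero, zero_add] at h
  let := hΓ.isInternal_restrictOdd.chooseDecomposition
  let := hΓ.isInternal_restrictEven.chooseDecomposition
  refine funext fun j => le_antisymm (hle j) fun T hT => ?_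
  refine mem_of_decompose_eq_zero (restrictOdd Γ) fun i hi => ?_
  have hdec : ∀ (S : Matrix (Fin N) (Fin N) ℂ) (i : ℤ), (decompose (restrictEven Γ) S i : Matrix (Fin N) (Fin N) ℂ) =
      (decompose (restrictOdd Γ) S i : Matrix (Fin N) (Fin N) ℂ) := fun S i => by
    induction S using Decomposition.inductionOn (restrictOdd Γ) with
    | zero => simp
    | add x y hx hy => simp [hx, hy]
    | @homogeneous k x =>
      rcases eq_or_ne k i with rfl | hk
      · rw [decompose_of_mem_same _ x.2, decompose_of_mem_same _ (hle _ x.2)]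
      · rw [decompose_of_mem_ne _ x.2 hk, decompose_of_mem_ne _ (hle _ x.2) hk]
  rw [← hdec, decompose_of_mem_ne _ hT hi.symm]

/-- If the center of `q(N)` has degree zero, then the grading of the even part is a grading of the
associative algebra of matrices. -/
noncomputable abbrev gradedAlgebra (hΓ : IsZGrading Γ) (h1 : 1 ∈ restrictEven Γ 0) :
    GradedAlgebra (restrictEven Γ) where
  toDecomposition := hΓ.isInternal_restrictEven.chooseDecomposition
  one_mem := h1
  mul_mem i j S T hS hT := by
    have hodd := hΓ.restrictOdd_eq_restrictEven h1
    have hp := hΓ.anticommutator_mem_restrictEven (hodd ▸ hS) (hodd ▸ hT)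
    have hm := hΓ.commutator_mem_restrictOdd hS (hodd ▸ hT)
    rw [hodd] at hm
    have h := add_mem hp hm
    rwa [show S * T + T * S + (S * T - T * S) = (2 : ℂ) • (S * T) by rw [two_smul]; abel,
      Submodule.smul_mem_iff _ two_ne_zero] at h

end IsZGrading

/-- The value at `(S, S'; S', S)` of the functional corresponding to a matrix `e`. -/
lemma oddForm_oddIncl (e : Matrix (Fin N) (Fin N) ℂ) (X : queer N) :
    oddForm (oddIncl N e) X = trace (e * diagBlock X) := by
  conv_lhs => rw [← mk_blocks X, oddIncl_apply, oddForm_mk, zero_mul, zero_add]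

/-! ### The centralizer of `χ` in terms of `e` -/

variable {χ : Module.Dual ℂ (queer N)} {e : Matrix (Fin N) (Fin N) ℂ}

lemma evenIncl_mem_centralizer_iff (hχ : ∀ X, χ X = trace (e * diagBlock X))
    (Y : Matrix (Fin N) (Fin N) ℂ) :
    evenIncl N Y ∈ LinearMap.ker ((bracket N).compr₂ χ) ↔ e * Y = Y * e := by
  have key : ∀ X, χ (bracket N (evenIncl N Y) X) = trace ((e * Y - Y * e) * diagBlock X) :=
    fun X => by
      rw [hχ, ← mk_blocks X, evenIncl_apply, bracket_mk, diagBlock_mk, diagBlock_mk, mul_add,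
        zero_mul, mul_zero, add_zero, mul_zero, add_zero, mul_sub, sub_mul, trace_sub, trace_sub,
        ← mul_assoc, ← mul_assoc, Matrix.trace_mul_cycle e (diagBlock X) Y]
  rw [LinearMap.mem_ker, ← sub_eq_zero (a := e * Y), Matrix.ext_iff_trace_mul_right]
  constructor
  · intro h T
    rw [zero_mul, trace_zero, ← diagBlock_mk T 0, ← key]
    exact LinearMap.congr_fun h (mk T 0)
  · intro h
    ext1 X
    rw [LinearMap.compr₂_apply, key, h, zero_mul, trace_zero, LinearMap.zero_apply]

/-- The bracket of two odd elements is an anticommutator, so cyclicity and nondegeneracy of the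
trace form give the anticentralizer here. -/
lemma oddIncl_mem_centralizer_iff (hχ : ∀ X, χ X = trace (e * diagBlock X))
    (Y : Matrix (Fin N) (Fin N) ℂ) :
    oddIncl N Y ∈ LinearMap.ker ((bracket N).compr₂ χ) ↔ e * Y + Y * e = 0 := by
  have key : ∀ X, χ (bracket N (oddIncl N Y) X) = trace ((e * Y + Y * e) * offBlock X) :=
    fun X => by
      rw [hχ, ← mk_blocks X, oddIncl_apply, bracket_mk, diagBlock_mk, offBlock_mk, zero_mul,
        mul_zero, sub_zero, zero_add, mul_add, add_mul, trace_add, trace_add,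
        ← mul_assoc, ← mul_assoc, Matrix.trace_mul_cycle e (offBlock X) Y]
  rw [LinearMap.mem_ker, Matrix.ext_iff_trace_mul_right]
  constructor
  · intro h T
    rw [zero_mul, trace_zero, ← offBlock_mk 0 T, ← key]
    exact LinearMap.congr_fun h (mk 0 T)
  · intro h
    ext1 X
    rw [LinearMap.compr₂_apply, key, h, zero_mul, trace_zero, LinearMap.zero_apply]

lemma mem_ker_ad_iff (Y : Matrix (Fin N) (Fin N) ℂ) :
    Y ∈ LinearMap.ker (LieAlgebra.ad ℂ (Matrix (Fin N) (Fin N) ℂ) e) ↔ e * Y = Y * e := by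
  rw [LinearMap.mem_ker, LieAlgebra.ad_apply, Ring.lie_def, sub_eq_zero]

/-! ### The two implications -/

open DirectSum in
lemma IsGoodGrading.isGoodLieGrading (hΓ : IsGoodGrading χ Γ)
    (hχ : ∀ X, χ X = trace (e * diagBlock X)) : IsGoodLieGrading e (restrictEven Γ) := by
  have h1 : 1 ∈ restrictEven Γ 0 := hΓ.center_le evenIncl_one_mem_center
  let := hΓ.toIsZGrading.gradedAlgebra h1
  refine ⟨hΓ.toIsZGrading.isLieZGrading_restrictEven, ?_, ?_, ?_⟩
  · intro S hS
    obtain ⟨c, rfl⟩ := exists_eq_smul_one_of_forall_commute (X := S) fun Y => by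
      have h := (LieModule.mem_maxTrivSubmodule _ _ _ S).mp hS Y
      rw [Ring.lie_def, sub_eq_zero] at h
      exact h.symm
    exact Submodule.smul_mem _ _ h1
  -- A component of `e` of degree `i ≠ 2` is trace-orthogonal to everything: only degree `-i` could
  -- pair with it, and there the pairing equals the value of `χ`, which vanishes because `-i ≠ -2`.
  · refine mem_of_decompose_eq_zero _ fun i hi => ?_
    rw [Matrix.ext_iff_trace_mul_right]
    intro T
    rw [zero_mul, trace_zero]
    induction T using Decomposition.inductionOn (restrictEven Γ) with
    | zero => simp
    | add x y hx hy => rw [mul_add, trace_add, hx, hy, add_zero]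
    | @homogeneous j x =>
      rcases ne_or_eq (i + j) 0 with hij | hij
      · exact Matrix.trace_mul_eq_zero_of_graded (restrictEven Γ) hij (SetLike.coe_mem _) x.2
      · have hx := hΓ.apply_eq_zero j (by lia) _ x.2
        rw [hχ, evenIncl_apply, diagBlock_mk] at hx
        classical
        rw [← sum_support_decompose (restrictEven Γ) e, Finset.sum_mul, trace_sum,
          Finset.sum_eq_single i] at hx
        · exact hx
        · intro k _ hk
          exact Matrix.trace_mul_eq_zero_of_graded (restrictEven Γ) (by lia) (SetLike.coe_mem _) x.2
        · intro hi'
          rw [DFinsupp.notMem_support_iff] at hi'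
          simp [hi']
  · intro Y hY
    rw [mem_ker_ad_iff, ← evenIncl_mem_centralizer_iff hχ] at hY
    have hY' := hΓ.centralizer_le (Submodule.mem_sup_left ⟨rfl, hY⟩)
    have hle : ⨆ j : ℤ, ⨆ _ : 0 ≤ j, Γ j ≤
        (⨆ j : ℤ, ⨆ _ : 0 ≤ j, restrictEven Γ j).comap (diagBlockₗ N) :=
      iSup₂_le fun j hj X hX => Submodule.mem_iSup_of_mem j (Submodule.mem_iSup_of_mem hj
        (hΓ.toIsZGrading.blocks_mem hX).1)
    exact hle hY'

lemma IsZGrading.isGoodGrading (hΓ : IsZGrading Γ) (hχ : ∀ X, χ X = trace (e * diagBlock X))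
    (hgood : IsGoodLieGrading e (restrictEven Γ)) : IsGoodGrading χ Γ := by
  have h1 : 1 ∈ restrictEven Γ 0 := hgood.center_le <|
    (LieModule.mem_maxTrivSubmodule _ _ _ _).mpr fun Y => by rw [Ring.lie_def, mul_one, one_mul, sub_self]
  let := hΓ.gradedAlgebra h1
  have hcent : ∀ Y, e * Y = Y * e → Y ∈ ⨆ j : ℤ, ⨆ _ : 0 ≤ j, restrictEven Γ j :=
    fun Y hY => hgood.centralizer_le ((mem_ker_ad_iff Y).mpr hY)
  refine ⟨hΓ, ?_, ?_, ?_⟩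
  · intro X hX
    obtain ⟨c, rfl⟩ := exists_eq_evenIncl_of_mem_center hX
    rw [map_smul]
    exact Submodule.smul_mem _ _ h1
  · intro j hj X hX
    rw [hχ]
    exact Matrix.trace_mul_eq_zero_of_graded (restrictEven Γ) (by lia) hgood.mem_two
      (hΓ.blocks_mem hX).1
  · refine sup_le ?_ ?_
    · rintro X ⟨hXe, hX⟩
      rw [← mem_even_iff.mp hXe] at hX ⊢
      have hle : ⨆ j : ℤ, ⨆ _ : 0 ≤ j, restrictEven Γ j ≤
          (⨆ j : ℤ, ⨆ _ : 0 ≤ j, Γ j).comap (evenIncl N) :=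
        iSup₂_le fun j hj => Submodule.comap_mono (le_iSup₂_of_le j hj le_rfl)
      exact hle (hcent _ ((evenIncl_mem_centralizer_iff hχ _).mp hX))
    · rintro X ⟨hXo, hX⟩
      rw [← mem_odd_iff.mp hXo] at hX ⊢
      have hle : ⨆ j : ℤ, ⨆ _ : 0 ≤ j, restrictOdd Γ j ≤
          (⨆ j : ℤ, ⨆ _ : 0 ≤ j, Γ j).comap (oddIncl N) :=
        iSup₂_le fun j hj => Submodule.comap_mono (le_iSup₂_of_le j hj le_rfl)
      apply hle
      -- Degrees in the odd part may be read off in `gl(N)`, where the anticentralizer is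
      -- controlled.
      rw [hΓ.restrictOdd_eq_restrictEven h1]
      exact Matrix.mem_nonneg_of_anticommute (restrictEven Γ) hgood.mem_two hcent
        ((oddIncl_mem_centralizer_iff hχ _).mp hX)

end Queer

theorem mainTheorem5 (N : ℕ) (χ : Module.Dual ℂ (queer N)) (hχ : Queer.IsNilpotentFunctional χ)
    (E : queer N) (hE : E ∈ Queer.odd N) (hχE : ∀ X, χ X = Queer.oddForm E X)
    (e : Matrix (Fin N) (Fin N) ℂ) (he : Queer.evenIncl N e = Queer.parity N E)
    (Γ : ℤ → Submodule ℂ (queer N)) (hΓ : Queer.IsZGrading Γ) :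
    Queer.IsGoodGrading χ Γ ↔ IsGoodLieGrading e (Queer.restrictEven Γ) := by
  have hEe : E = Queer.oddIncl N e := by
    rw [← Queer.mem_odd_iff.mp hE, show Queer.offBlock E = e from
      (congrArg Queer.diagBlock he).symm]
  have hχe : ∀ X, χ X = trace (e * Queer.diagBlock X) := fun X => by
    rw [hχE, hEe, Queer.oddForm_oddIncl]
  exact ⟨fun h => h.isGoodLieGrading hχe, hΓ.isGoodGrading hχe⟩
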